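/- Here a triangulated model with $n$ triangles is a finite geometric simplicial complex in some $\mathbb{R}^d$ (in particular $d=3$) consisting of $n$ triangles together with their edges and vertices, such that every edge lies in one triangle (a boundary edge, at a hole of the model) or in two triangles; holes are allowed. A model is connected if it has at least one triangle and any two of its triangles are joined by a chain of triangles in which consecutive triangles share an edge. (For a triangulated surface with boundary this is the same as connectedness of the surface.) A subdivision of a model $K$ is a model $L$ that covers the same point set, each of whose simplices lies in a simplex of $K$, and each of whose vertices is a vertex of $K$ or the midpoint of an edge of $K$. A single triangle strip of $L$ is an ordering of all triangles of $L$, each occurring exactly once, in which consecutive triangles share an edge. Theorem. There is an absolute constant $C$ such that every connected triangulated model with $n$ triangles, with or without holes, has a subdivision that forms a single triangle strip with at most $$3n-4\log_2 n+C$$ triangles. -/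

import Mathlib

namespace Strip

/-- The space `ℝ^d`. -/
abbrev Space (d : ℕ) := EuclideanSpace ℝ (Fin d)

/-- A simplicial complex in `ℝ^d`. -/
abbrev Complex (d : ℕ) := Geometry.SimplicialComplex ℝ (Space d)

/-- The triangles of a complex: its faces with three vertices. -/
def triangles {d : ℕ} (K : Complex d) : Set (Finset (Space d)) :=
  {t | t ∈ K.faces ∧ t.card = 3}

/-- A triangulated model: finitely many triangles of `ℝ^d` (with their edges and vertices) that meet
edge-to-edge, every edge lying in one triangle (a boundary edge) or in two triangles. -/
structure IsModel {d : ℕ} (K : Complex d) : Prop where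
  finite : K.faces.Finite
  pure : ∀ s ∈ K.faces, ∃ t ∈ triangles K, s ⊆ t
  edge_le_two : ∀ e ∈ K.faces, e.card = 2 → {t | t ∈ triangles K ∧ e ⊆ t}.encard ≤ 2

/-- Two different triangles that have an edge in common. -/
def ShareEdge {d : ℕ} (s t : Finset (Space d)) : Prop :=
  s ≠ t ∧ ∃ e : Finset (Space d), e.card = 2 ∧ e ⊆ s ∧ e ⊆ t

/-- The dual graph: its nodes are the triangles, two of them joined if they share an edge. -/
def dualGraph {d : ℕ} (K : Complex d) : SimpleGraph (triangles K) where
  Adj s t := ShareEdge s.1 t.1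
  symm := ⟨fun _ _ h => ⟨h.1.symm, h.2.imp fun _ he => ⟨he.1, he.2.2, he.2.1⟩⟩⟩
  loopless := ⟨fun _ h => h.1 rfl⟩

/-- Connectedness of a model: there is a triangle, and any two triangles are joined by a chain of
triangles in which consecutive ones share an edge. -/
def EdgeConnected {d : ℕ} (K : Complex d) : Prop := (dualGraph K).Connected

/-- `L` subdivides `K`: both cover the same point set, every simplex of `L` lies in a simplex of
`K`, and every vertex of `L` is a vertex of `K` or the midpoint of an edge of `K`. -/
structure IsSubdivision {d : ℕ} (K L : Complex d) : Prop where
  space_eq : L.space = K.space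
  refines : ∀ s ∈ L.faces, ∃ t ∈ K.faces,
    convexHull ℝ (s : Set (Space d)) ⊆ convexHull ℝ (t : Set (Space d))
  midpoints : ∀ x ∈ L.vertices, x ∈ K.vertices ∨
    ∃ e ∈ K.faces, e.card = 2 ∧ ∃ a ∈ e, ∃ b ∈ e, a ≠ b ∧ x = midpoint ℝ a b

/-- `l` is a single triangle strip of `L`: it lists every triangle of `L` exactly once, and
consecutive triangles share an edge. -/
structure IsStrip {d : ℕ} (L : Complex d) (l : List (Finset (Space d))) : Prop where
  nodup : l.Nodup
  mem_iff : ∀ t, t ∈ l ↔ t ∈ triangles L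
  chain : l.IsChain ShareEdge

/-- Why `EdgeConnected` is the right notion: if the triangles around every vertex form a single
fan (the condition for a surface with boundary to be a manifold at that vertex), a model whose
underlying space is connected is edge-connected. -/
theorem edgeConnected_of_isConnected_space {d : ℕ} {K : Complex d} (hK : IsModel K)
    (hfan : ∀ v : Space d, ((dualGraph K).induce {t | v ∈ t.1}).Preconnected)
    (hconn : IsConnected K.space) : EdgeConnected K := by
  classical
  have hne : Nonempty (triangles K) := by
    obtain ⟨x, hx⟩ := hconn.nonempty
    obtain ⟨s, hs, -⟩ := Geometry.SimplicialComplex.mem_space_iff.1 hx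
    obtain ⟨t, ht, -⟩ := hK.pure s hs
    exact ⟨⟨t, ht⟩⟩
  have hfin : (triangles K).Finite := hK.finite.subset fun t ht => ht.1
  have : Finite (triangles K) := hfin
  refine (SimpleGraph.connected_iff _).2 ⟨fun s t => ?_, hne⟩
  by_contra hst
  let A : Set (Space d) := ⋃ u : {u : triangles K // (dualGraph K).Reachable s u},
    convexHull ℝ (u.1.1 : Set (Space d))
  let B : Set (Space d) := ⋃ u : {u : triangles K // ¬ (dualGraph K).Reachable s u},
    convexHull ℝ (u.1.1 : Set (Space d))
  have hcl : ∀ u : Finset (Space d), IsClosed (convexHull ℝ (u : Set (Space d))) := fun u =>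
    (Set.Finite.isCompact_convexHull ℝ u.finite_toSet).isClosed
  have hA : IsClosed A := isClosed_iUnion_of_finite fun u => hcl _
  have hB : IsClosed B := isClosed_iUnion_of_finite fun u => hcl _
  have hcov : K.space ⊆ A ∪ B := by
    intro x hx
    obtain ⟨u, hu, hxu⟩ := Geometry.SimplicialComplex.mem_space_iff.1 hx
    obtain ⟨w, hw, huw⟩ := hK.pure u hu
    have hxw : x ∈ convexHull ℝ (w : Set (Space d)) :=
      convexHull_mono (Finset.coe_subset.2 huw) hxu
    by_cases h : (dualGraph K).Reachable s ⟨w, hw⟩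
    · exact Or.inl (Set.mem_iUnion.2 ⟨⟨⟨w, hw⟩, h⟩, hxw⟩)
    · exact Or.inr (Set.mem_iUnion.2 ⟨⟨⟨w, hw⟩, h⟩, hxw⟩)
  have hmeet : ∀ u : triangles K, ∃ x, x ∈ K.space ∧ x ∈ convexHull ℝ (u.1 : Set (Space d)) := by
    intro u
    obtain ⟨x, hx⟩ := Geometry.SimplicialComplex.nonempty_of_mem_faces u.2.1
    exact ⟨x, Geometry.SimplicialComplex.subset_space u.2.1 hx, subset_convexHull ℝ _ hx⟩
  have hsA : (K.space ∩ A).Nonempty := by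
    obtain ⟨x, hx, hxs⟩ := hmeet s
    exact ⟨x, hx, Set.mem_iUnion.2 ⟨⟨s, SimpleGraph.Reachable.refl s⟩, hxs⟩⟩
  have htB : (K.space ∩ B).Nonempty := by
    obtain ⟨x, hx, hxt⟩ := hmeet t
    exact ⟨x, hx, Set.mem_iUnion.2 ⟨⟨t, hst⟩, hxt⟩⟩
  obtain ⟨x, -, hxA, hxB⟩ :=
    isPreconnected_closed_iff.1 hconn.isPreconnected A B hA hB hcov hsA htB
  obtain ⟨⟨u, hu⟩, hxu⟩ := Set.mem_iUnion.1 hxA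
  obtain ⟨⟨w, hw⟩, hxw⟩ := Set.mem_iUnion.1 hxB
  have hx := K.inter_subset_convexHull u.2.1 w.2.1 ⟨hxu, hxw⟩
  obtain ⟨v, hvu, hvw⟩ := convexHull_nonempty_iff.1 ⟨x, hx⟩
  have hr := hfan v ⟨u, hvu⟩ ⟨w, hvw⟩
  exact hw (hu.trans (hr.map (SimpleGraph.Embedding.induce _).toHom))

end Strip

/-! Follow a strip through the model and suppose that it misses a triangle `t` sharing an edge with
a triangle `s` of the strip. Bisecting that edge cuts `s` and `t` into halves through which the
strip can be led on a detour, so it absorbs `t` at the cost of three more triangles. A strip that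
starts as a path of `p` triangles in the dual graph therefore ends with `p + 3 (n - p) = 3 n - 2 p`
triangles.

A long path exists since the dual graph has maximum degree three: in a spanning tree, the ball
around the midpoint of a longest path whose radius is half the diameter is the whole tree, and a
ball of radius `R` has at most `3 * 2 ^ R` nodes, so that `p ≥ 2 log₂ n - O(1)`. -/

namespace Strip

section Weights

variable {𝕜 E ι : Type*} [Field 𝕜] [AddCommGroup E] [Module 𝕜 E]

theorem affineIndependent_iff_linearIndependent_one_prod {p : ι → E} :
    AffineIndependent 𝕜 p ↔ LinearIndependent 𝕜 fun i => ((1 : 𝕜), p i) := by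
  simp only [affineIndependent_iff, linearIndependent_iff', Prod.smul_mk, smul_eq_mul, mul_one,
    Prod.ext_iff, Prod.fst_sum, Prod.snd_sum, Prod.fst_zero, Prod.snd_zero, and_imp]

/-- The linear map sending a weighting `w` of points to its total weight and its weighted sum of
points; this is the linear combination of the points `(1, x)` of the cone over `E`. -/
noncomputable def cone : (E →₀ 𝕜) →ₗ[𝕜] 𝕜 × E :=
  Finsupp.linearCombination 𝕜 fun x => ((1 : 𝕜), x)

theorem cone_eq_sum {s : Finset E} {w : E →₀ 𝕜} (hw : w.support ⊆ s) :
    cone w = (∑ y ∈ s, w y, ∑ y ∈ s, w y • y) := by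
  rw [cone, Finsupp.linearCombination_apply, Finsupp.sum_of_support_subset w hw _ (by simp)]
  simp only [Prod.smul_mk, smul_eq_mul, mul_one, Prod.ext_iff, Prod.fst_sum, Prod.snd_sum,
    and_self]

theorem eq_of_cone_eq {s : Finset E} (hs : AffineIndependent 𝕜 ((↑) : s → E)) {w v : E →₀ 𝕜}
    (hw : w.support ⊆ s) (hv : v.support ⊆ s) (h : cone w = cone v) : w = v := by
  classical
  have hlin : LinearIndepOn 𝕜 (fun x : E => ((1 : 𝕜), x)) s :=
    affineIndependent_iff_linearIndependent_one_prod.1 hs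
  refine sub_eq_zero.1 (linearIndepOn_iff.1 hlin (w - v) ?_ ?_)
  · exact Finset.coe_subset.2 (Finsupp.support_sub.trans (Finset.union_subset hw hv))
  · exact (map_sub cone w v).trans (sub_eq_zero.2 h)

theorem affineIndependent_of_cone {s : Finset E}
    (h : ∀ w : E →₀ 𝕜, w.support ⊆ s → cone w = 0 → w = 0) :
    AffineIndependent 𝕜 ((↑) : s → E) :=
  affineIndependent_iff_linearIndependent_one_prod.2
    (linearIndepOn_iff (s := (s : Set E)).2 fun w hw => h w (Finset.coe_subset.1 hw))

variable [LinearOrder 𝕜]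

/-- `w` is a system of convex weights on the vertices of `s` whose barycenter is `x`. -/
structure Represents (s : Finset E) (w : E →₀ 𝕜) (x : E) : Prop where
  support_subset : w.support ⊆ s
  nonneg : ∀ y, 0 ≤ w y
  cone_eq : cone w = (1, x)

theorem Represents.exists_apply_eq_zero {s σ : Finset E} {w : E →₀ 𝕜} {x : E}
    (hw : Represents s w x) (hσ : ¬ σ ⊆ s) : ∃ y ∈ σ, w y = 0 := by
  obtain ⟨y, hy, hys⟩ := Finset.not_subset.1 hσ
  exact ⟨y, hy, Finsupp.notMem_support_iff.1 fun h => hys (hw.support_subset h)⟩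

variable [IsStrictOrderedRing 𝕜]

theorem mem_convexHull_iff_exists_represents {s : Finset E} {x : E} :
    x ∈ convexHull 𝕜 (s : Set E) ↔ ∃ w : E →₀ 𝕜, Represents s w x := by
  classical
  rw [Finset.mem_convexHull']
  constructor
  · rintro ⟨w, h0, h1, hx⟩
    have hs := Finsupp.support_indicator_subset s fun y _ => w y
    refine ⟨Finsupp.indicator s fun y _ => w y, hs, fun y => ?_, ?_⟩
    · rw [Finsupp.indicator_apply]
      split_ifs with hy
      exacts [h0 y hy, le_rfl]
    · rw [cone_eq_sum hs, ← h1, ← hx]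
      refine Prod.ext (Finset.sum_congr rfl fun y hy => ?_)
        (Finset.sum_congr rfl fun y hy => ?_) <;>
        rw [Finsupp.indicator_of_mem hy]
  · rintro ⟨w, hw⟩
    have h := hw.cone_eq
    rw [cone_eq_sum hw.support_subset, Prod.ext_iff] at h
    exact ⟨w, fun y _ => hw.nonneg y, h⟩

theorem Represents.eq_of_mem_faces {L : Geometry.SimplicialComplex 𝕜 E} {s t : Finset E}
    {w v : E →₀ 𝕜} {x : E} (hw : Represents s w x) (hv : Represents t v x) (hs : s ∈ L.faces)
    (ht : t ∈ L.faces) : w = v := by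
  classical
  have hx := L.inter_subset_convexHull hs ht
    ⟨mem_convexHull_iff_exists_represents.2 ⟨w, hw⟩, mem_convexHull_iff_exists_represents.2 ⟨v, hv⟩⟩
  rw [← Finset.coe_inter] at hx
  obtain ⟨u, hu⟩ := mem_convexHull_iff_exists_represents.1 hx
  trans u
  · exact eq_of_cone_eq (L.indep hs) hw.support_subset
      (hu.support_subset.trans Finset.inter_subset_left) (hw.cone_eq.trans hu.cone_eq.symm)
  · exact eq_of_cone_eq (L.indep ht) (hu.support_subset.trans Finset.inter_subset_right)
      hv.support_subset (hu.cone_eq.trans hv.cone_eq.symm)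

end Weights

section Relation

variable {𝕜 E : Type*} [Field 𝕜] {σ s : Finset E} {m y : E} {w v : E →₀ 𝕜}

/-- The linear relation between the vertices of `σ` and its barycenter `m`, as a weighting: moving
along it shifts weight evenly from the vertices of `σ` to `m`. -/
noncomputable def relation (σ : Finset E) (m : E) : E →₀ 𝕜 :=
  ∑ y ∈ σ, (Finsupp.single m 1 - Finsupp.single y 1)

theorem relation_apply_center (hm : m ∉ σ) : (relation σ m : E →₀ 𝕜) m = σ.card := by
  have h : ∀ y ∈ σ, (Finsupp.single m 1 - Finsupp.single y 1 : E →₀ 𝕜) m = 1 := fun y hy => by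
    rw [Finsupp.sub_apply, Finsupp.single_eq_same,
      Finsupp.single_eq_of_ne (ne_of_mem_of_not_mem hy hm).symm, sub_zero]
  rw [relation, Finsupp.finsetSum_apply, Finset.sum_congr rfl h, Finset.sum_const, nsmul_one]

theorem relation_apply_of_mem (hym : y ≠ m) (hy : y ∈ σ) : (relation σ m : E →₀ 𝕜) y = -1 := by
  classical
  simp only [relation, Finsupp.finsetSum_apply, Finsupp.sub_apply, Finsupp.single_apply, hym.symm,
    if_false, zero_sub, Finset.sum_neg_distrib, Finset.sum_ite_eq', hy, if_true]

theorem relation_apply_of_notMem (hym : y ≠ m) (hy : y ∉ σ) : (relation σ m : E →₀ 𝕜) y = 0 := by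
  classical
  simp only [relation, Finsupp.finsetSum_apply, Finsupp.sub_apply, Finsupp.single_apply, hym.symm,
    if_false, zero_sub, Finset.sum_neg_distrib, Finset.sum_ite_eq', hy, neg_zero]

theorem cone_relation [CharZero 𝕜] [AddCommGroup E] [Module 𝕜 E] (hσ : σ.Nonempty) :
    cone (relation σ (σ.centroid 𝕜 id) : E →₀ 𝕜) = 0 := by
  have hcard : (σ.card : 𝕜) ≠ 0 := Nat.cast_ne_zero.2 hσ.card_ne_zero
  have hsum : (σ.card : 𝕜) • σ.centroid 𝕜 id = ∑ y ∈ σ, y := by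
    rw [Finset.centroid_def, Finset.affineCombination_eq_linear_combination _ _ _
      (σ.sum_centroidWeights_eq_one_of_nonempty 𝕜 hσ), Finset.smul_sum]
    exact Finset.sum_congr rfl fun y _ => smul_inv_smul₀ hcard y
  have hdiff : ∀ y ∈ σ, cone (Finsupp.single (σ.centroid 𝕜 id) 1 - Finsupp.single y 1 : E →₀ 𝕜) =
      (0, σ.centroid 𝕜 id - y) := fun y _ => by
    simp only [cone, map_sub, Finsupp.linearCombination_single, one_smul, Prod.mk_sub_mk, sub_self]
  rw [relation, map_sum, Finset.sum_congr rfl hdiff, ← Prod.mk_zero_zero, Prod.ext_iff,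
    Prod.fst_sum, Prod.snd_sum]
  refine ⟨Finset.sum_const_zero, ?_⟩
  rw [Finset.sum_sub_distrib, Finset.sum_const, ← Nat.cast_smul_eq_nsmul 𝕜, hsum, sub_self]

theorem centroid_notMem [CharZero 𝕜] [AddCommGroup E] [Module 𝕜 E]
    (hind : AffineIndependent 𝕜 ((↑) : σ → E)) (hσ : σ.Nontrivial) : σ.centroid 𝕜 id ∉ σ := by
  intro hm
  obtain ⟨y, hy, hym⟩ := hσ.exists_ne (σ.centroid 𝕜 id)
  have hsupp : (relation σ (σ.centroid 𝕜 id) : E →₀ 𝕜).support ⊆ σ := fun z hz => by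
    by_contra hzσ
    exact Finsupp.mem_support_iff.1 hz
      (relation_apply_of_notMem (ne_of_mem_of_not_mem hm hzσ).symm hzσ)
  have hzero : (relation σ (σ.centroid 𝕜 id) : E →₀ 𝕜) = 0 :=
    eq_of_cone_eq hind hsupp (Finset.empty_subset _)
      ((cone_relation hσ.nonempty).trans (map_zero cone).symm)
  have hneg : (relation σ (σ.centroid 𝕜 id) : E →₀ 𝕜) y = -1 := relation_apply_of_mem hym hy
  rw [hzero, Finsupp.zero_apply] at hneg
  exact one_ne_zero (neg_eq_zero.1 hneg.symm)

/-- The weighting `w` with the weight of the barycenter `m` of `σ` distributed evenly among the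
vertices of `σ`. -/
noncomputable def spread (σ : Finset E) (m : E) (w : E →₀ 𝕜) : E →₀ 𝕜 :=
  w - (w m / σ.card) • relation σ m

theorem spread_apply_center [CharZero 𝕜] (hσ : σ.Nonempty) (hm : m ∉ σ) : spread σ m w m = 0 := by
  rw [spread, Finsupp.sub_apply, Finsupp.smul_apply, relation_apply_center hm, smul_eq_mul,
    div_mul_cancel₀ _ (Nat.cast_ne_zero.2 hσ.card_ne_zero), sub_self]

theorem spread_apply_of_mem (hm : m ∉ σ) (hy : y ∈ σ) :
    spread σ m w y = w y + w m / σ.card := by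
  rw [spread, Finsupp.sub_apply, Finsupp.smul_apply,
    relation_apply_of_mem (ne_of_mem_of_not_mem hy hm) hy, smul_eq_mul, mul_neg_one,
    sub_neg_eq_add]

theorem spread_apply_of_notMem (hym : y ≠ m) (hy : y ∉ σ) : spread σ m w y = w y := by
  rw [spread, Finsupp.sub_apply, Finsupp.smul_apply, relation_apply_of_notMem hym hy, smul_zero,
    sub_zero]

theorem eq_of_spread_eq (h : spread σ m w = spread σ m v) (hm : w m = v m) : w = v := by
  rw [spread, spread, hm] at h
  exact sub_left_injective h

theorem cone_spread [CharZero 𝕜] [AddCommGroup E] [Module 𝕜 E] (hσ : σ.Nonempty) :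
    cone (spread σ (σ.centroid 𝕜 id) w) = cone w := by
  rw [spread, map_sub, map_smul, cone_relation hσ, smul_zero, sub_zero]

theorem apply_center_le_of_spread_eq [LinearOrder 𝕜] [IsStrictOrderedRing 𝕜] (hm : m ∉ σ)
    (hy : y ∈ σ) (hwy : w y = 0) (hvy : 0 ≤ v y) (h : spread σ m w = spread σ m v) :
    v m ≤ w m := by
  have hcard : (0 : 𝕜) < σ.card := Nat.cast_pos.2 (Finset.card_pos.2 ⟨y, hy⟩)
  have hwv : spread σ m w y = spread σ m v y := by rw [h]
  rw [spread_apply_of_mem hm hy, spread_apply_of_mem hm hy, hwy, zero_add] at hwv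
  exact (div_le_div_iff_of_pos_right hcard).1 (hwv ▸ le_add_of_nonneg_left hvy)

end Relation

section Carrier

variable {E : Type*} [DecidableEq E] {σ s t u : Finset E} {m z : E}

/-- The smallest simplex with old vertices that contains the simplex `s` when `m` is a point in the
interior of the simplex `σ`. -/
def carrier (σ : Finset E) (m : E) (s : Finset E) : Finset E :=
  if m ∈ s then σ ∪ s.erase m else s

/-- The simplex obtained from `u` by exchanging its vertex `z` for `m`. -/
def exchange (u : Finset E) (z m : E) : Finset E := insert m (u.erase z)

theorem carrier_of_notMem (hm : m ∉ s) : carrier σ m s = s := if_neg hm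

theorem carrier_mono (hst : s ⊆ t) : carrier σ m s ⊆ carrier σ m t := by
  grind [carrier]

theorem carrier_nonempty (hσ : σ.Nonempty) (hs : s.Nonempty) : (carrier σ m s).Nonempty := by
  by_cases hm : m ∈ s
  · rw [carrier, if_pos hm]
    exact hσ.mono Finset.subset_union_left
  · rwa [carrier_of_notMem hm]

theorem subset_insert_carrier : s ⊆ insert m (carrier σ m s) := by
  grind [carrier]

theorem carrier_exchange (hσ : σ ⊆ u) (hz : z ∈ σ) (hm : m ∉ u) :
    carrier σ m (exchange u z m) = u := by
  grind [carrier, exchange]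

theorem not_subset_exchange (hz : z ∈ σ) (hm : m ∉ σ) : ¬ σ ⊆ exchange u z m := by
  grind [exchange]

theorem subset_carrier (hm : m ∈ s) : σ ⊆ carrier σ m s := by
  grind [carrier]

theorem mem_carrier_of_mem_of_ne {p : E} (hp : p ∈ s) (hpm : p ≠ m) : p ∈ carrier σ m s := by
  grind [carrier]

theorem carrier_eq_of_not_subset (hs : ¬ σ ⊆ carrier σ m s) : carrier σ m s = s := by
  grind [carrier]

theorem subset_exchange (hs : s ⊆ insert m u) (hz : z ∉ s) : s ⊆ exchange u z m := by
  grind [exchange]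

theorem ne_of_mem_exchange {p : E} (hp : p ∈ exchange u z m) (hpm : p ≠ m) : p ≠ z := by
  grind [exchange]

theorem exchange_ne_exchange {y : E} (hz : z ∈ u) (hyz : y ≠ z) (hm : m ∉ u) :
    exchange u y m ≠ exchange t z m := by
  intro h
  have hmem : z ∈ exchange u y m := Finset.mem_insert_of_mem (Finset.mem_erase.2 ⟨hyz.symm, hz⟩)
  exact ne_of_mem_exchange (h ▸ hmem) (ne_of_mem_of_not_mem hz hm) rfl

theorem card_exchange (hz : z ∈ u) (hm : m ∉ u) : (exchange u z m).card = u.card := by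
  rw [exchange, Finset.card_insert_of_notMem fun h => hm (Finset.mem_of_mem_erase h),
    Finset.card_erase_add_one hz]

theorem exchange_mono (hs : s ⊆ u) : exchange s z m ⊆ exchange u z m :=
  Finset.insert_subset_insert _ (Finset.erase_subset_erase _ hs)

theorem support_spread_subset {𝕜 : Type*} [Field 𝕜] [CharZero 𝕜] {w : E →₀ 𝕜} (hσ : σ.Nonempty)
    (hm : m ∉ σ) (hw : w.support ⊆ s) : (spread σ m w).support ⊆ carrier σ m s := by
  intro y hy
  rw [Finsupp.mem_support_iff] at hy
  have hzero : ∀ x ∉ s, w x = 0 := fun x hx => Finsupp.notMem_support_iff.1 fun h => hx (hw h)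
  have hym : y ≠ m := by
    rintro rfl
    exact hy (spread_apply_center hσ hm)
  by_cases hyσ : y ∈ σ
  · by_cases hms : m ∈ s
    · grind [carrier]
    · rw [spread_apply_of_mem hm hyσ, hzero m hms, zero_div, add_zero] at hy
      grind [carrier]
  · rw [spread_apply_of_notMem hym hyσ] at hy
    grind [carrier]

end Carrier

section Stellar

variable {𝕜 E : Type*} [Field 𝕜] [LinearOrder 𝕜] [IsStrictOrderedRing 𝕜] [AddCommGroup E]
  [Module 𝕜 E] {L : Geometry.SimplicialComplex 𝕜 E} {σ s t u : Finset E} {w : E →₀ 𝕜} {x : E}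

theorem centroid_notMem_of_mem_faces (hσ : σ ∈ L.faces) (hnt : σ.Nontrivial) (hs : s ∈ L.faces) :
    σ.centroid 𝕜 id ∉ s := by
  intro h
  have hvert : σ.centroid 𝕜 id ∈ L.vertices :=
    L.down_closed hs (Finset.singleton_subset_iff.2 h) (Finset.singleton_nonempty _)
  exact centroid_notMem (L.indep hσ) hnt
    ((Geometry.SimplicialComplex.vertex_mem_convexHull_iff hvert hσ).1
      (σ.centroid_mem_convexHull hnt.nonempty))

variable [DecidableEq E]

theorem Represents.spread (hσ : σ.Nonempty) (hm : σ.centroid 𝕜 id ∉ σ) (hw : Represents s w x) :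
    Represents (carrier σ (σ.centroid 𝕜 id) s) (spread σ (σ.centroid 𝕜 id) w) x := by
  refine ⟨support_spread_subset hσ hm hw.support_subset, fun y => ?_,
    (cone_spread hσ).trans hw.cone_eq⟩
  by_cases hyσ : y ∈ σ
  · rw [spread_apply_of_mem hm hyσ]
    exact add_nonneg (hw.nonneg y) (div_nonneg (hw.nonneg _) (Nat.cast_nonneg _))
  · by_cases hym : y = σ.centroid 𝕜 id
    · rw [hym, spread_apply_center hσ hm]
    · rw [spread_apply_of_notMem hym hyσ]
      exact hw.nonneg y

theorem convexHull_subset_carrier (hσ : σ.Nonempty) (hm : σ.centroid 𝕜 id ∉ σ) :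
    convexHull 𝕜 (s : Set E) ⊆ convexHull 𝕜 (carrier σ (σ.centroid 𝕜 id) s : Set E) := by
  intro x hx
  obtain ⟨w, hw⟩ := mem_convexHull_iff_exists_represents.1 hx
  exact mem_convexHull_iff_exists_represents.2 ⟨_, hw.spread hσ hm⟩

/-- The stellar subdivision of `L` at the barycenter `m` of its face `σ`. A set of old vertices and
`m` is a face as soon as it does not contain `σ` and its carrier is a face of `L`. -/
noncomputable def stellar (L : Geometry.SimplicialComplex 𝕜 E) (σ : Finset E) (hσ : σ ∈ L.faces)
    (hnt : σ.Nontrivial) : Geometry.SimplicialComplex 𝕜 E where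
  faces := {s | ¬ σ ⊆ s ∧ carrier σ (σ.centroid 𝕜 id) s ∈ L.faces}
  isRelLowerSet_faces := by
    rintro s ⟨hσs, hs⟩
    refine ⟨?_, fun t hts ht => ⟨fun h => hσs (h.trans hts),
      L.down_closed hs (carrier_mono hts) (carrier_nonempty hnt.nonempty ht)⟩⟩
    rw [Finset.nonempty_iff_ne_empty]
    rintro rfl
    rw [carrier_of_notMem (Finset.notMem_empty _)] at hs
    exact (L.nonempty_of_mem_faces hs).ne_empty rfl
  indep {s} hs := by
    have hm := centroid_notMem (L.indep hσ) hnt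
    refine affineIndependent_of_cone fun w hw hw0 => ?_
    have hspread : spread σ (σ.centroid 𝕜 id) w = 0 :=
      eq_of_cone_eq (L.indep hs.2) (support_spread_subset hnt.nonempty hm hw)
        (Finset.empty_subset _) ((cone_spread hnt.nonempty).trans (hw0.trans (map_zero _).symm))
    obtain ⟨y, hy, hys⟩ := Finset.not_subset.1 hs.1
    have hwm := spread_apply_of_mem (w := w) hm hy
    rw [hspread, Finsupp.notMem_support_iff.1 fun h => hys (hw h), zero_add, Finsupp.zero_apply,
      eq_comm, div_eq_zero_iff, or_iff_left (Nat.cast_ne_zero.2 hnt.nonempty.card_ne_zero)] at hwm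
    rwa [spread, hwm, zero_div, zero_smul, sub_zero] at hspread
  inter_subset_convexHull := by
    rintro s t hs ht x ⟨hxs, hxt⟩
    have hm := centroid_notMem (L.indep hσ) hnt
    obtain ⟨w, hw⟩ := mem_convexHull_iff_exists_represents.1 hxs
    obtain ⟨v, hv⟩ := mem_convexHull_iff_exists_represents.1 hxt
    have hspread := (hw.spread hnt.nonempty hm).eq_of_mem_faces (hv.spread hnt.nonempty hm)
      hs.2 ht.2
    obtain ⟨y, hy, hwy⟩ := hw.exists_apply_eq_zero hs.1
    obtain ⟨z, hz, hvz⟩ := hv.exists_apply_eq_zero ht.1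
    obtain rfl : w = v := eq_of_spread_eq hspread <| le_antisymm
      (apply_center_le_of_spread_eq hm hz hvz (hw.nonneg z) hspread.symm)
      (apply_center_le_of_spread_eq hm hy hwy (hv.nonneg y) hspread)
    rw [← Finset.coe_inter]
    exact mem_convexHull_iff_exists_represents.2
      ⟨w, Finset.subset_inter hw.support_subset hv.support_subset, hw.nonneg, hw.cone_eq⟩

variable (hσ : σ ∈ L.faces) (hnt : σ.Nontrivial)

theorem mem_faces_stellar_of_not_subset (hs : s ∈ L.faces) (hσs : ¬ σ ⊆ s) :
    s ∈ (stellar L σ hσ hnt).faces := by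
  refine ⟨hσs, ?_⟩
  rwa [carrier_of_notMem (centroid_notMem_of_mem_faces hσ hnt hs)]

theorem exchange_mem_faces_stellar (hu : u ∈ L.faces) (hσu : σ ⊆ u) {z : E} (hz : z ∈ σ) :
    exchange u z (σ.centroid 𝕜 id) ∈ (stellar L σ hσ hnt).faces := by
  refine ⟨not_subset_exchange hz (centroid_notMem (L.indep hσ) hnt), ?_⟩
  rwa [carrier_exchange hσu hz (centroid_notMem_of_mem_faces hσ hnt hu)]

theorem stellar_refines (hs : s ∈ (stellar L σ hσ hnt).faces) :
    ∃ t ∈ L.faces, convexHull 𝕜 (s : Set E) ⊆ convexHull 𝕜 (t : Set E) :=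
  ⟨_, hs.2, convexHull_subset_carrier hnt.nonempty (centroid_notMem (L.indep hσ) hnt)⟩

/-- The vertices of `σ` give away weight to `m` until one of them, `z`, has none left. -/
theorem Represents.exists_exchange (hw : Represents u w x) (hσ : σ.Nonempty)
    (hm : σ.centroid 𝕜 id ∉ σ) (hσu : σ ⊆ u) :
    ∃ z ∈ σ, ∃ v : E →₀ 𝕜, Represents (exchange u z (σ.centroid 𝕜 id)) v x := by
  obtain ⟨z, hz, hmin⟩ := σ.exists_min_image w hσ
  have happly : ∀ y, (w + w z • relation σ (σ.centroid 𝕜 id) : E →₀ 𝕜) y =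
      w y + w z * relation σ (σ.centroid 𝕜 id) y := fun y => rfl
  refine ⟨z, hz, w + w z • relation σ (σ.centroid 𝕜 id), fun y hy => ?_, fun y => ?_, ?_⟩
  · rw [Finsupp.mem_support_iff, happly] at hy
    by_contra hyu
    have hym : y ≠ σ.centroid 𝕜 id := by grind [exchange]
    by_cases hyz : y = z
    · rw [hyz, relation_apply_of_mem (ne_of_mem_of_not_mem hz hm) hz] at hy
      exact hy (by ring)
    · have hyu' : y ∉ u := by grind [exchange]
      rw [relation_apply_of_notMem hym fun h => hyu' (hσu h), mul_zero, add_zero] at hy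
      exact hyu' (hw.support_subset (Finsupp.mem_support_iff.2 hy))
  · rw [happly]
    by_cases hyσ : y ∈ σ
    · rw [relation_apply_of_mem (ne_of_mem_of_not_mem hyσ hm) hyσ]
      linarith [hmin y hyσ]
    · by_cases hym : y = σ.centroid 𝕜 id
      · rw [hym, relation_apply_center hm]
        exact add_nonneg (hw.nonneg _) (mul_nonneg (hw.nonneg _) (Nat.cast_nonneg _))
      · rw [relation_apply_of_notMem hym hyσ, mul_zero, add_zero]
        exact hw.nonneg y
  · rw [map_add, map_smul, cone_relation hσ, smul_zero, add_zero, hw.cone_eq]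

theorem space_stellar : (stellar L σ hσ hnt).space = L.space := by
  refine Set.Subset.antisymm (fun x hx => ?_) fun x hx => ?_
  · obtain ⟨s, hs, hxs⟩ := Geometry.SimplicialComplex.mem_space_iff.1 hx
    obtain ⟨t, ht, hst⟩ := stellar_refines hσ hnt hs
    exact Geometry.SimplicialComplex.mem_space_iff.2 ⟨t, ht, hst hxs⟩
  · obtain ⟨u, hu, hxu⟩ := Geometry.SimplicialComplex.mem_space_iff.1 hx
    rw [Geometry.SimplicialComplex.mem_space_iff]
    by_cases hσu : σ ⊆ u
    · obtain ⟨w, hw⟩ := mem_convexHull_iff_exists_represents.1 hxu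
      obtain ⟨z, hz, v, hv⟩ :=
        hw.exists_exchange hnt.nonempty (centroid_notMem (L.indep hσ) hnt) hσu
      exact ⟨_, exchange_mem_faces_stellar hσ hnt hu hσu hz,
        mem_convexHull_iff_exists_represents.2 ⟨v, hv⟩⟩
    · exact ⟨u, mem_faces_stellar_of_not_subset hσ hnt hu hσu, hxu⟩

theorem vertices_stellar_subset :
    (stellar L σ hσ hnt).vertices ⊆ insert (σ.centroid 𝕜 id) L.vertices := by
  intro x hx
  by_cases hxm : x = σ.centroid 𝕜 id
  · exact Or.inl hxm
  · have hcarrier : carrier σ (σ.centroid 𝕜 id) {x} ∈ L.faces := hx.2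
    rw [carrier_of_notMem (fun h => hxm (Finset.mem_singleton.1 h).symm)] at hcarrier
    exact Or.inr hcarrier

theorem finite_faces_stellar (hL : L.faces.Finite) : (stellar L σ hσ hnt).faces.Finite := by
  refine (hL.biUnion fun u _ => (Finset.finite_toSet
    (insert (σ.centroid 𝕜 id) u).powerset)).subset fun s hs => ?_
  exact Set.mem_biUnion hs.2 (Finset.mem_coe.2 (Finset.mem_powerset.2 subset_insert_carrier))

end Stellar

section Graph

variable {V W : Type*} {G : SimpleGraph V}

theorem ncard_biUnion_le_mul {ι α : Type*} {s : Set ι} (hs : s.Finite) {f : ι → Set α} {m : ℕ}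
    (hf : ∀ i ∈ s, (f i).ncard ≤ m) : (⋃ i ∈ s, f i).ncard ≤ s.ncard * m := by
  induction s, hs using Set.Finite.induction_on with
  | empty => simp
  | @insert i s hi hs ih =>
    rw [Set.biUnion_insert, Set.ncard_insert_of_notMem hi hs, Nat.succ_mul, add_comm]
    exact (Set.ncard_union_le _ _).trans (add_le_add (hf i (s.mem_insert i))
      (ih fun j hj => hf j (s.mem_insert_of_mem i hj)))

theorem exists_adj_dist_eq_of_dist_eq_succ {c v : V} {k : ℕ} (h : G.dist c v = k + 1) :
    ∃ u, G.Adj u v ∧ G.dist c u = k := by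
  obtain ⟨p, hp⟩ := G.exists_walk_of_dist_ne_zero (u := c) (v := v) (by lia)
  have hnil : ¬ p.Nil := by
    rw [← SimpleGraph.Walk.length_eq_zero_iff]
    lia
  have hadj := p.adj_penultimate hnil
  have hle : G.dist c p.penultimate ≤ k := by
    have := SimpleGraph.dist_le p.dropLast
    have := p.length_dropLast_add_one hnil
    lia
  have := hadj.diff_dist_adj (u := c)
  exact ⟨_, hadj, by lia⟩

theorem ncard_dist_eq_succ_le [Finite V] {d : ℕ} (hdeg : ∀ v, (G.neighborSet v).ncard ≤ d + 1)
    (c : V) (k : ℕ) : {v | G.dist c v = k + 1}.ncard ≤ (d + 1) * d ^ k := by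
  induction k with
  | zero =>
    simp only [zero_add, SimpleGraph.dist_eq_one_iff_adj, pow_zero, mul_one]
    exact hdeg c
  | succ k ih =>
    let N (u : V) : Set V := G.neighborSet u \ {v | G.dist c v = k}
    have hcover : {v | G.dist c v = k + 1 + 1} ⊆ ⋃ u ∈ {u | G.dist c u = k + 1}, N u := by
      intro v hv
      obtain ⟨u, huv, hu⟩ := exists_adj_dist_eq_of_dist_eq_succ hv
      refine Set.mem_biUnion hu ⟨huv, fun hvk : G.dist c v = k => ?_⟩
      have : G.dist c v = k + 1 + 1 := hv
      lia
    have hN : ∀ u ∈ {u | G.dist c u = k + 1}, (N u).ncard ≤ d := by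
      intro u hu
      obtain ⟨v, hvu, hv⟩ := exists_adj_dist_eq_of_dist_eq_succ hu
      have : (N u).ncard < (G.neighborSet u).ncard :=
        Set.ncard_lt_ncard ⟨Set.sdiff_subset, fun h => (h hvu.symm).2 hv⟩
      have := hdeg u
      lia
    exact (Set.ncard_le_ncard hcover).trans
      ((ncard_biUnion_le_mul (Set.toFinite _) hN).trans (by rw [pow_succ, ← mul_assoc]; gcongr))

theorem ncard_dist_le_le [Finite V] {d : ℕ} (hG : G.Connected)
    (hdeg : ∀ v, (G.neighborSet v).ncard ≤ d + 1) (c : V) (R : ℕ) :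
    {v | G.dist c v ≤ R}.ncard ≤ 1 + (d + 1) * ∑ k ∈ Finset.range R, d ^ k := by
  induction R with
  | zero => simp [hG.dist_eq_zero_iff]
  | succ R ih =>
    have hsplit : {v | G.dist c v ≤ R + 1} = {v | G.dist c v ≤ R} ∪ {v | G.dist c v = R + 1} :=
      Set.ext fun v => Nat.le_succ_iff
    rw [hsplit, Finset.sum_range_succ, mul_add, ← add_assoc]
    exact (Set.ncard_union_le _ _).trans (add_le_add ih (ncard_dist_eq_succ_le hdeg c R))

theorem dist_add_dist_of_mem_support {x y c : V} {p : G.Walk x y} (hp : p.length = G.dist x y)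
    (hc : c ∈ p.support) : G.dist x c + G.dist c y = G.dist x y := by
  classical
  refine le_antisymm ?_ ((p.takeUntil c hc).reachable.dist_triangle_left y)
  rw [← hp, ← p.take_spec hc, SimpleGraph.Walk.length_append]
  gcongr <;> exact SimpleGraph.dist_le _

theorem support_subset_of_isAcyclic (hG : G.IsAcyclic) {x y : V} {p : G.Walk x y} (hp : p.IsPath)
    (q : G.Walk x y) : p.support ⊆ q.support := by
  classical
  have hpq : p = q.bypass := congrArg Subtype.val ((hG.subsingleton_path x y).elim ⟨p, hp⟩ q.toPath)
  exact hpq ▸ q.support_bypass_subset_support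

theorem exists_forall_dist_le_of_isTree [Finite V] (hG : G.IsTree) :
    ∃ c, ∀ v, G.dist c v ≤ (G.diam + 1) / 2 := by
  have hconn := hG.connected
  have := hconn.nonempty
  obtain ⟨x, y, hxy⟩ := G.exists_dist_eq_diam
  obtain ⟨p, hp, hlen⟩ := hconn.exists_path_of_dist x y
  let c := p.getVert (G.diam / 2)
  have hc : c ∈ p.support := p.getVert_mem_support _
  have hxc : G.dist x c = G.diam / 2 := by
    rw [← SimpleGraph.length_eq_dist_of_subwalk hlen (p.isSubwalk_take _),
      SimpleGraph.Walk.take_length]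
    lia
  have hcy := dist_add_dist_of_mem_support hlen hc
  have hdiam : ∀ u v, G.dist u v ≤ G.diam := fun u v =>
    SimpleGraph.dist_le_diam (SimpleGraph.connected_iff_ediam_ne_top.1 hconn)
  refine ⟨c, fun z => ?_⟩
  obtain ⟨q₁, hq₁⟩ := hconn.exists_walk_length_eq_dist x z
  obtain ⟨q₂, hq₂⟩ := hconn.exists_walk_length_eq_dist z y
  have hxz := hdiam x z
  have hzy := hdiam z y
  rcases (SimpleGraph.Walk.mem_support_append_iff _ _).1
    (support_subset_of_isAcyclic hG.isAcyclic hp (q₁.append q₂) hc) with h | h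
  · have := dist_add_dist_of_mem_support hq₁ h
    lia
  · have := dist_add_dist_of_mem_support hq₂ h
    rw [SimpleGraph.dist_comm (u := z)] at this
    lia

theorem exists_isPath_card_le [Finite V] {d : ℕ} (hG : G.Connected)
    (hdeg : ∀ v, (G.neighborSet v).ncard ≤ d + 1) :
    ∃ (x y : V) (p : G.Walk x y), p.IsPath ∧
      Nat.card V ≤ 1 + (d + 1) * ∑ k ∈ Finset.range ((p.length + 1) / 2), d ^ k := by
  obtain ⟨T, hTG, hT⟩ := hG.exists_isTree_le
  obtain ⟨c, hc⟩ := exists_forall_dist_le_of_isTree hT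
  have := hG.nonempty
  obtain ⟨x, y, hxy⟩ := T.exists_dist_eq_diam
  obtain ⟨p, hp, hlen⟩ := hT.connected.exists_path_of_dist x y
  refine ⟨x, y, p.mapLe hTG, (SimpleGraph.Walk.isPath_mapLe hTG).2 hp, ?_⟩
  rw [SimpleGraph.Walk.length_map, hlen, hxy]
  have hball : {v | T.dist c v ≤ (T.diam + 1) / 2} = Set.univ := Set.eq_univ_of_forall hc
  rw [← Set.ncard_univ, ← hball]
  exact ncard_dist_le_le hT.connected
    (fun v => (Set.ncard_le_ncard fun _ h => hTG h).trans (hdeg v)) c _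

theorem preconnected_of_lift {H : SimpleGraph W} (f : W → V) (hG : G.Preconnected)
    (hfib : ∀ x y, f x = f y → H.Reachable x y)
    (hadj : ∀ u v, G.Adj u v → ∃ x y, f x = u ∧ f y = v ∧ H.Reachable x y) : H.Preconnected := by
  suffices h : ∀ u v, G.Walk u v → ∀ x y, f x = u → f y = v → H.Reachable x y from
    fun x y => (hG (f x) (f y)).elim fun p => h _ _ p x y rfl rfl
  intro u v p
  induction p with
  | nil => exact fun x y hx hy => hfib x y (hx.trans hy.symm)
  | cons huv _ ih =>
    intro x y hx hy
    obtain ⟨x', y', rfl, rfl, hxy⟩ := hadj _ _ huv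
    exact ((hfib x x' hx).trans hxy).trans (ih y' y rfl hy)

end Graph

section Models

variable {d : ℕ} {K L : Complex d} {e s t u : Finset (Space d)}

theorem IsSubdivision.refl : IsSubdivision K K :=
  ⟨rfl, fun s hs => ⟨s, hs, subset_rfl⟩, fun _ hx => Or.inl hx⟩

theorem ShareEdge.symm (h : ShareEdge s t) : ShareEdge t s :=
  ⟨h.1.symm, h.2.imp fun _ he => ⟨he.1, he.2.2, he.2.1⟩⟩

theorem IsModel.card_le_three (hL : IsModel L) (hs : s ∈ L.faces) : s.card ≤ 3 := by
  obtain ⟨t, ht, hst⟩ := hL.pure s hs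
  exact (Finset.card_le_card hst).trans ht.2.le

theorem IsModel.eq_or_eq_of_edge_subset (hL : IsModel L) (he : e.card = 2) (hs : s ∈ triangles L)
    (ht : t ∈ triangles L) (hu : u ∈ triangles L) (hes : e ⊆ s) (het : e ⊆ t) (heu : e ⊆ u)
    (hst : s ≠ t) : u = s ∨ u = t := by
  by_contra! hne
  have hface : e ∈ L.faces := L.down_closed hs.1 hes (Finset.card_pos.1 (he ▸ two_pos))
  have hle : ({u, s, t} : Set (Finset (Space d))).encard ≤ 2 :=
    (Set.encard_le_encard (by
      rintro x (rfl | rfl | rfl)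
      exacts [⟨hu, heu⟩, ⟨hs, hes⟩, ⟨ht, het⟩])).trans (hL.edge_le_two e hface he)
  rw [Set.encard_eq_three.2 ⟨u, s, t, hne.1, hne.2, hst, rfl⟩] at hle
  exact absurd hle (by decide)

theorem ShareEdge.card_inter [DecidableEq (Space d)] (h : ShareEdge s t) (hs : s.card = 3)
    (ht : t.card = 3) :
    (s ∩ t).card = 2 := by
  obtain ⟨hne, e, he, hes, het⟩ := h
  refine le_antisymm (Nat.lt_succ_iff.1 (lt_of_not_ge fun hge => hne ?_))
    (he ▸ Finset.card_le_card (Finset.subset_inter hes het))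
  exact (Finset.eq_of_subset_of_card_le Finset.inter_subset_left (hs.le.trans hge)).symm.trans
    (Finset.eq_of_subset_of_card_le Finset.inter_subset_right (ht.le.trans hge))

theorem IsModel.ncard_neighborSet_le (hL : IsModel L) (s : triangles L) :
    ((dualGraph L).neighborSet s).ncard ≤ 3 := by
  classical
  have hcard : (s.1.powersetCard 2).card = 3 := by
    rw [Finset.card_powersetCard, s.2.2]
    rfl
  rw [← hcard, ← Set.ncard_coe_finset]
  have hinter : ∀ t ∈ (dualGraph L).neighborSet s, (s.1 ∩ t.1).card = 2 :=
    fun t ht => ShareEdge.card_inter ht s.2.2 t.2.2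
  refine Set.ncard_le_ncard_of_injOn (fun t => s.1 ∩ t.1)
    (fun t ht => Finset.mem_powersetCard.2 ⟨Finset.inter_subset_left, hinter t ht⟩)
    fun t ht u hu htu => ?_
  have htu : s.1 ∩ t.1 = s.1 ∩ u.1 := htu
  rcases hL.eq_or_eq_of_edge_subset (hinter t ht) s.2 t.2 u.2 Finset.inter_subset_left
    Finset.inter_subset_right (htu ▸ Finset.inter_subset_right) ht.1 with h | h
  · exact absurd h.symm hu.1
  · exact Subtype.ext h.symm

end Models

section Bisection

variable {d : ℕ} {K L : Complex d} {e s t u v x : Finset (Space d)}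

variable (he : e ∈ L.faces) (he2 : e.card = 2)

include he he2 in
theorem centroid_notMem_of_mem_triangles (hs : s ∈ triangles L) : e.centroid ℝ id ∉ s :=
  centroid_notMem_of_mem_faces he (Finset.one_lt_card_iff_nontrivial.1 (he2 ▸ one_lt_two)) hs.1

include he he2 in
theorem centroid_notMem_edge : e.centroid ℝ id ∉ e :=
  centroid_notMem_of_mem_faces he (Finset.one_lt_card_iff_nontrivial.1 (he2 ▸ one_lt_two)) he

variable [DecidableEq (Space d)]

/-- The complex obtained from `L` by bisecting its edge `e` together with all the triangles that
contain `e`. -/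
noncomputable def bisect (L : Complex d) (he : e ∈ L.faces) (he2 : e.card = 2) : Complex d :=
  stellar L e he (Finset.one_lt_card_iff_nontrivial.1 (he2 ▸ one_lt_two))

theorem exchange_mem_triangles_bisect (hu : u ∈ triangles L) (heu : e ⊆ u) {z : Space d}
    (hz : z ∈ e) : exchange u z (e.centroid ℝ id) ∈ triangles (bisect L he he2) := by
  refine ⟨exchange_mem_faces_stellar he _ hu.1 heu hz, ?_⟩
  have hm := centroid_notMem_of_mem_triangles he he2 hu
  rw [card_exchange (heu hz) hm, hu.2]

theorem mem_triangles_bisect_of_not_subset (ht : t ∈ triangles L) (het : ¬ e ⊆ t) :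
    t ∈ triangles (bisect L he he2) :=
  ⟨mem_faces_stellar_of_not_subset he _ ht.1 het, ht.2⟩

variable (hL : IsModel L)

include hL in
theorem IsModel.mem_triangles_bisect : t ∈ triangles (bisect L he he2) ↔
    t ∈ triangles L ∧ ¬ e ⊆ t ∨
      ∃ u ∈ triangles L, e ⊆ u ∧ ∃ z ∈ e, t = exchange u z (e.centroid ℝ id) := by
  constructor
  · rintro ⟨⟨het, hcarrier⟩, ht⟩
    by_cases hm : e.centroid ℝ id ∈ t
    · obtain ⟨z, hz, hzt⟩ := Finset.not_subset.1 het
      rw [carrier, if_pos hm] at hcarrier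
      have hle := hL.card_le_three hcarrier
      have hsub : t.erase (e.centroid ℝ id) ⊆ (e ∪ t.erase (e.centroid ℝ id)).erase z :=
        Finset.subset_erase.2 ⟨Finset.subset_union_right, fun h => hzt (Finset.mem_of_mem_erase h)⟩
      have herase : (t.erase (e.centroid ℝ id)).card = 2 := by
        rw [Finset.card_erase_of_mem hm, ht]
      have hz' : z ∈ e ∪ t.erase (e.centroid ℝ id) := Finset.mem_union_left _ hz
      have hcard := Finset.card_erase_add_one hz'
      have hge := Finset.card_le_card hsub
      refine Or.inr ⟨_, ⟨hcarrier, by omega⟩, Finset.subset_union_left, z, hz, ?_⟩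
      rw [exchange, ← Finset.eq_of_subset_of_card_le hsub (by omega), Finset.insert_erase hm]
    · rw [carrier_of_notMem hm] at hcarrier
      exact Or.inl ⟨⟨hcarrier, ht⟩, het⟩
  · rintro (⟨ht, het⟩ | ⟨u, hu, heu, z, hz, rfl⟩)
    · exact mem_triangles_bisect_of_not_subset he he2 ht het
    · exact exchange_mem_triangles_bisect he he2 hu heu hz

include hL in
theorem IsModel.carrier_mem_triangles (ht : t ∈ triangles (bisect L he he2)) :
    carrier e (e.centroid ℝ id) t ∈ triangles L := by
  rcases (hL.mem_triangles_bisect he he2).1 ht with ⟨ht, -⟩ | ⟨u, hu, heu, z, hz, rfl⟩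
  · rwa [carrier_of_notMem (centroid_notMem_of_mem_triangles he he2 ht)]
  · rwa [carrier_exchange heu hz (centroid_notMem_of_mem_triangles he he2 hu)]

include hL in
theorem IsModel.exists_eq_exchange (ht : t ∈ triangles (bisect L he he2))
    (het : e ⊆ carrier e (e.centroid ℝ id) t) :
    ∃ z ∈ e, t = exchange (carrier e (e.centroid ℝ id) t) z (e.centroid ℝ id) := by
  rcases (hL.mem_triangles_bisect he he2).1 ht with ⟨ht', het'⟩ | ⟨u, hu, heu, z, hz, rfl⟩
  · rw [carrier_of_notMem (centroid_notMem_of_mem_triangles he he2 ht')] at het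
    exact absurd het het'
  · rw [carrier_exchange heu hz (centroid_notMem_of_mem_triangles he he2 hu)]
    exact ⟨z, hz, rfl⟩

theorem exists_mem_triangles_bisect_carrier_eq (hu : u ∈ triangles L)
    (hxu : x ⊆ insert (e.centroid ℝ id) u) (hex : ¬ e ⊆ x) (hmx : e.centroid ℝ id ∈ x → e ⊆ u) :
    ∃ t ∈ triangles (bisect L he he2), x ⊆ t ∧ carrier e (e.centroid ℝ id) t = u := by
  have hmu := centroid_notMem_of_mem_triangles he he2 hu
  by_cases heu : e ⊆ u
  · obtain ⟨z, hz, hzx⟩ := Finset.not_subset.1 hex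
    exact ⟨_, exchange_mem_triangles_bisect he he2 hu heu hz, subset_exchange hxu hzx,
      carrier_exchange heu hz hmu⟩
  · exact ⟨u, mem_triangles_bisect_of_not_subset he he2 hu heu,
      (Finset.subset_insert_iff_of_notMem fun h => heu (hmx h)).1 hxu, carrier_of_notMem hmu⟩

include hL in
theorem IsModel.exists_mem_triangles_bisect_superset (hs : s ∈ (bisect L he he2).faces) :
    ∃ t ∈ triangles (bisect L he he2), s ⊆ t := by
  obtain ⟨hes, hcarrier⟩ := hs
  obtain ⟨u, hu, hsu⟩ := hL.pure _ hcarrier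
  obtain ⟨t, ht, hst, -⟩ := exists_mem_triangles_bisect_carrier_eq he he2 hu (x := s)
    (subset_insert_carrier.trans (Finset.insert_subset_insert _ hsu)) hes
    fun hm => (subset_carrier hm).trans hsu
  exact ⟨t, ht, hst⟩

theorem injOn_carrier_of_centroid_notMem {f : Finset (Space d)} (hf : f.card = 2)
    (hm : e.centroid ℝ id ∉ f) :
    Set.InjOn (carrier e (e.centroid ℝ id)) {t | t ∈ triangles (bisect L he he2) ∧ f ⊆ t} := by
  rintro s ⟨hs, hfs⟩ t ⟨ht, hft⟩ hst
  have hface : ∀ {s}, s ∈ triangles (bisect L he he2) → f ⊆ s → e.centroid ℝ id ∈ s →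
      insert (e.centroid ℝ id) f = s := fun hs hfs hms =>
    Finset.eq_of_subset_of_card_le (Finset.insert_subset hms hfs)
      (by rw [Finset.card_insert_of_notMem hm, hf, hs.2])
  have hes := hs.1.1
  have het := ht.1.1
  by_cases hms : e.centroid ℝ id ∈ s <;> by_cases hmt : e.centroid ℝ id ∈ t
  · rw [← hface hs hfs hms, hface ht hft hmt]
  · exact absurd (subset_carrier hms) (by rwa [hst, carrier_of_notMem hmt])
  · exact absurd (subset_carrier hmt) (by rwa [← hst, carrier_of_notMem hms])
  · rwa [carrier_of_notMem hms, carrier_of_notMem hmt] at hst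

include hL in
theorem IsModel.injOn_carrier_of_mem {f : Finset (Space d)} {p : Space d}
    (hm : e.centroid ℝ id ∈ f) (hpf : p ∈ f) (hpe : p ∈ e) :
    Set.InjOn (carrier e (e.centroid ℝ id)) {t | t ∈ triangles (bisect L he he2) ∧ f ⊆ t} := by
  rintro s ⟨hs, hfs⟩ t ⟨ht, hft⟩ hst
  have hes : e ⊆ carrier e (e.centroid ℝ id) s := subset_carrier (hfs hm)
  obtain ⟨y, hy, hsy⟩ := hL.exists_eq_exchange he he2 hs hes
  obtain ⟨z, hz, htz⟩ := hL.exists_eq_exchange he he2 ht (hst ▸ hes)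
  have hpm : p ≠ e.centroid ℝ id := ne_of_mem_of_not_mem hpe (centroid_notMem_edge he he2)
  have hpy : p ≠ y := ne_of_mem_exchange (hsy ▸ hfs hpf) hpm
  have hpz : p ≠ z := ne_of_mem_exchange (htz ▸ hft hpf) hpm
  have hyz : y = z := Finset.card_le_one.1 (by rw [Finset.card_erase_of_mem hpe, he2]) y
    (Finset.mem_erase.2 ⟨hpy.symm, hy⟩) z (Finset.mem_erase.2 ⟨hpz.symm, hz⟩)
  rw [hsy, htz, hst, hyz]

include hL in
theorem IsModel.encard_triangles_bisect_le_two {f : Finset (Space d)}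
    (hf : f ∈ (bisect L he he2).faces) (hf2 : f.card = 2) :
    {t | t ∈ triangles (bisect L he he2) ∧ f ⊆ t}.encard ≤ 2 := by
  by_cases hm : e.centroid ℝ id ∈ f
  · obtain ⟨p, hp⟩ := Finset.card_eq_one.1 ((Finset.card_erase_of_mem hm).trans (by rw [hf2]))
    obtain ⟨hpm, hpf⟩ := Finset.mem_erase.1 (hp ▸ Finset.mem_singleton_self p)
    by_cases hpe : p ∈ e
    · exact (Set.encard_le_encard_of_injOn (t := {t | t ∈ triangles L ∧ e ⊆ t})
        (fun t ht => ⟨hL.carrier_mem_triangles he he2 ht.1, subset_carrier (ht.2 hm)⟩)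
        (hL.injOn_carrier_of_mem he he2 hm hpf hpe)).trans (hL.edge_le_two e he he2)
    · refine (Set.encard_le_encard (t := (fun z => exchange (insert p e) z (e.centroid ℝ id)) ''
        (e : Set (Space d))) fun t ht => ?_).trans ((Set.encard_image_le _ _).trans
          (by rw [Set.encard_coe_eq_coe_finsetCard, he2]; rfl))
      have hu := hL.carrier_mem_triangles he he2 ht.1
      have heu : insert p e ⊆ carrier e (e.centroid ℝ id) t :=
        Finset.insert_subset (mem_carrier_of_mem_of_ne (ht.2 hpf) hpm) (subset_carrier (ht.2 hm))
      obtain ⟨z, hz, htz⟩ := hL.exists_eq_exchange he he2 ht.1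
        ((Finset.subset_insert _ _).trans heu)
      refine ⟨z, hz, ?_⟩
      have hcard : (insert p e).card = 3 := by rw [Finset.card_insert_of_notMem hpe, he2]
      rw [htz]
      exact congrArg (exchange · z _)
        (Finset.eq_of_subset_of_card_le heu (hu.2.trans hcard.symm).le)
  · have hcarrier := hf.2
    rw [carrier_of_notMem hm] at hcarrier
    refine (Set.encard_le_encard_of_injOn (t := {t | t ∈ triangles L ∧ f ⊆ t})
      (fun t ht => ⟨hL.carrier_mem_triangles he he2 ht.1, ?_⟩)
      (injOn_carrier_of_centroid_notMem he he2 hf2 hm)).trans (hL.edge_le_two f hcarrier hf2)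
    rw [← carrier_of_notMem (σ := e) hm]
    exact carrier_mono ht.2

include hL in
theorem isModel_bisect : IsModel (bisect L he he2) where
  finite := finite_faces_stellar he _ hL.finite
  pure _ hs := hL.exists_mem_triangles_bisect_superset he he2 hs
  edge_le_two _ hf hf2 := hL.encard_triangles_bisect_le_two he he2 hf hf2

theorem shareEdge_exchange_exchange {y z m : Space d} (hu : u.card = 3) (hy : y ∈ u) (hz : z ∈ u)
    (hyz : y ≠ z) (hm : m ∉ u) : ShareEdge (exchange u y m) (exchange u z m) := by
  refine ⟨exchange_ne_exchange hz hyz hm, exchange (u.erase y) z m, ?_, ?_,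
    exchange_mono (Finset.erase_subset y u)⟩
  · rw [card_exchange (Finset.mem_erase.2 ⟨hyz.symm, hz⟩) fun h => hm (Finset.mem_of_mem_erase h),
      Finset.card_erase_of_mem hy, hu]
  · exact Finset.insert_subset_insert _ (Finset.erase_subset _ _)

include hL in
theorem IsModel.reachable_of_carrier_eq (s t : triangles (bisect L he he2))
    (hst : carrier e (e.centroid ℝ id) s.1 = carrier e (e.centroid ℝ id) t.1) :
    (dualGraph (bisect L he he2)).Reachable s t := by
  obtain ⟨s, hs⟩ := s
  obtain ⟨t, ht⟩ := t
  have hu := hL.carrier_mem_triangles he he2 hs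
  by_cases heu : e ⊆ carrier e (e.centroid ℝ id) s
  · obtain ⟨y, hy, hsy⟩ := hL.exists_eq_exchange he he2 hs heu
    obtain ⟨z, hz, htz⟩ := hL.exists_eq_exchange he he2 ht (hst ▸ heu)
    rw [← hst] at htz
    by_cases hyz : y = z
    · obtain rfl : s = t := by rw [hsy, htz, hyz]
      exact SimpleGraph.Reachable.refl _
    · have hshare := shareEdge_exchange_exchange hu.2 (heu hy) (heu hz) hyz
        (centroid_notMem_of_mem_triangles he he2 hu)
      rw [← hsy, ← htz] at hshare
      exact SimpleGraph.Adj.reachable hshare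
  · obtain rfl : s = t := by
      rw [← carrier_eq_of_not_subset heu, hst, carrier_eq_of_not_subset (hst ▸ heu)]
    exact SimpleGraph.Reachable.refl _

include he he2 in
/-- If `u` and `v` share the bisected edge itself, then `x` is one half of it. -/
theorem ShareEdge.exists_not_subset (hu : u ∈ triangles L) (huv : ShareEdge u v) :
    ∃ x : Finset (Space d), x.card = 2 ∧ ¬ e ⊆ x ∧ x ⊆ insert (e.centroid ℝ id) u ∧
      x ⊆ insert (e.centroid ℝ id) v ∧ (e.centroid ℝ id ∈ x → e ⊆ u ∧ e ⊆ v) := by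
  obtain ⟨-, f, hf, hfu, hfv⟩ := huv
  by_cases hef : e = f
  · subst hef
    obtain ⟨p, hp⟩ := Finset.card_pos.1 (he2 ▸ two_pos)
    have hm := centroid_notMem_edge he he2
    refine ⟨{e.centroid ℝ id, p}, Finset.card_pair (ne_of_mem_of_not_mem hp hm).symm,
      fun h => ?_, Finset.insert_subset_insert _ (Finset.singleton_subset_iff.2 (hfu hp)),
      Finset.insert_subset_insert _ (Finset.singleton_subset_iff.2 (hfv hp)),
      fun _ => ⟨hfu, hfv⟩⟩
    have hle := Finset.card_le_card ((Finset.subset_insert_iff_of_notMem hm).1 h)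
    rw [he2, Finset.card_singleton] at hle
    exact absurd hle (by decide)
  · have hmf : e.centroid ℝ id ∉ f := fun h => centroid_notMem_of_mem_triangles he he2 hu (hfu h)
    exact ⟨f, hf, fun h => hef (Finset.eq_of_subset_of_card_le h (hf.trans he2.symm).le),
      hfu.trans (Finset.subset_insert _ _), hfv.trans (Finset.subset_insert _ _),
      fun h => absurd h hmf⟩

include hL in
theorem edgeConnected_bisect (hconn : EdgeConnected L) : EdgeConnected (bisect L he he2) := by
  have hnot : ¬ e ⊆ ∅ := fun h => by simp [Finset.subset_empty.1 h] at he2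
  obtain ⟨u⟩ := hconn.nonempty
  obtain ⟨t, ht, -⟩ := exists_mem_triangles_bisect_carrier_eq he he2 u.2 (Finset.empty_subset _)
    hnot fun h => absurd h (Finset.notMem_empty _)
  refine (SimpleGraph.connected_iff _).2 ⟨preconnected_of_lift
    (fun t => ⟨carrier e (e.centroid ℝ id) t.1, hL.carrier_mem_triangles he he2 t.2⟩)
    hconn.preconnected
    (fun s t hst => hL.reachable_of_carrier_eq he he2 s t (congrArg Subtype.val hst)) ?_, ⟨⟨t, ht⟩⟩⟩
  rintro ⟨u, hu⟩ ⟨v, hv⟩ huv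
  obtain ⟨x, hx2, hex, hxu, hxv, hmx⟩ := ShareEdge.exists_not_subset he he2 hu huv
  obtain ⟨s, hs, hxs, rfl⟩ :=
    exists_mem_triangles_bisect_carrier_eq he he2 hu hxu hex fun h => (hmx h).1
  obtain ⟨t, ht, hxt, rfl⟩ :=
    exists_mem_triangles_bisect_carrier_eq he he2 hv hxv hex fun h => (hmx h).2
  exact ⟨⟨s, hs⟩, ⟨t, ht⟩, rfl, rfl, SimpleGraph.Adj.reachable
    ⟨fun h => huv.1 (congrArg (carrier e _) h), x, hx2, hxs, hxt⟩⟩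

theorem isSubdivision_bisect (hKL : IsSubdivision K L) (heK : e ∈ K.faces) :
    IsSubdivision K (bisect L he he2) where
  space_eq := (space_stellar he _).trans hKL.space_eq
  refines s hs := by
    obtain ⟨t, ht, hst⟩ := stellar_refines he _ hs
    obtain ⟨u, hu, htu⟩ := hKL.refines t ht
    exact ⟨u, hu, hst.trans htu⟩
  midpoints x hx := by
    rcases vertices_stellar_subset he _ hx with rfl | hx
    · obtain ⟨a, b, hab, rfl⟩ := Finset.card_eq_two.1 he2
      exact Or.inr ⟨_, heK, he2, a, by simp, b, by simp, hab, by
        rw [Finset.centroid_pair, midpoint, AffineMap.lineMap_apply, invOf_eq_inv]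
        rfl⟩
    · exact hKL.midpoints x hx

end Bisection

section PartialStrip

variable {d : ℕ} {K L : Complex d} {e s t u p : Finset (Space d)} {a b m z : Space d}
  {l l₁ l₂ : List (Finset (Space d))}

/-- A nonempty strip `l` that visits some of the triangles of `L`, each at most once. -/
structure IsPartialStrip (L : Complex d) (l : List (Finset (Space d))) : Prop where
  ne_nil : l ≠ []
  nodup : l.Nodup
  mem_triangles : ∀ t ∈ l, t ∈ triangles L
  chain : l.IsChain ShareEdge

/-- The triangles of `L` that the strip `l` does not visit yet. -/
def missing (L : Complex d) (l : List (Finset (Space d))) : Set (Finset (Space d)) :=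
  {t | t ∈ triangles L ∧ t ∉ l}

theorem IsPartialStrip.isStrip (hl : IsPartialStrip L l) (hmissing : missing L l = ∅) :
    IsStrip L l := by
  refine ⟨hl.nodup, fun t => ⟨hl.mem_triangles t, fun ht => ?_⟩, hl.chain⟩
  by_contra htl
  exact Set.eq_empty_iff_forall_notMem.1 hmissing t ⟨ht, htl⟩

theorem IsPartialStrip.ncard_missing_add_length [Finite (triangles L)] (hl : IsPartialStrip L l) :
    (missing L l).ncard + l.length = (triangles L).ncard := by
  classical
  have hsub : {t | t ∈ l} ⊆ triangles L := hl.mem_triangles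
  have hcard : {t | t ∈ l}.ncard = l.length := by
    rw [← List.coe_toFinset, Set.ncard_coe_finset, List.toFinset_card_of_nodup hl.nodup]
  rw [← hcard]
  exact Set.ncard_sdiff_add_ncard_of_subset hsub

theorem isPartialStrip_of_isPath {x y : triangles L} {p : (dualGraph L).Walk x y}
    (hp : p.IsPath) : IsPartialStrip L (p.support.map Subtype.val) where
  ne_nil h := p.support_ne_nil (List.map_eq_nil_iff.1 h)
  nodup := hp.support_nodup.map Subtype.val_injective
  mem_triangles t ht := by
    obtain ⟨u, -, rfl⟩ := List.mem_map.1 ht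
    exact u.2
  chain := (List.isChain_map Subtype.val).2 p.isChain_adj_support

theorem EdgeConnected.exists_shareEdge_missing (hconn : EdgeConnected L)
    (hl : IsPartialStrip L l) (hmissing : (missing L l).Nonempty) :
    ∃ s ∈ l, ∃ t ∈ missing L l, ShareEdge s t := by
  obtain ⟨t, ht, htl⟩ := hmissing
  obtain ⟨s, hs⟩ := List.exists_mem_of_ne_nil l hl.ne_nil
  obtain ⟨walk⟩ := hconn.preconnected ⟨s, hl.mem_triangles s hs⟩ ⟨t, ht⟩
  obtain ⟨dart, -, hfst, hsnd⟩ := walk.exists_boundary_dart {u | u.1 ∈ l} hs htl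
  exact ⟨_, hfst, _, ⟨dart.snd.2, hsnd⟩, dart.adj⟩

variable [DecidableEq (Space d)]

theorem IsModel.exists_erase_subset_of_shareEdge (hL : IsModel L) (he2 : e.card = 2)
    (hs : s ∈ triangles L) (ht : t ∈ triangles L) (hp : p ∈ triangles L) (hes : e ⊆ s)
    (het : e ⊆ t) (hst : s ≠ t) (hpt : p ≠ t) (hsp : ShareEdge s p) : ∃ z ∈ e, s.erase z ⊆ p := by
  obtain ⟨hne, f, hf, hfs, hfp⟩ := hsp
  have hep : ¬ e ⊆ p := fun hep =>
    (hL.eq_or_eq_of_edge_subset he2 hs ht hp hes het hep hst).elim hne.symm hpt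
  obtain ⟨z, hz, hzp⟩ := Finset.not_subset.1 hep
  have hfz : f = s.erase z := Finset.eq_of_subset_of_card_le
    (Finset.subset_erase.2 ⟨hfs, fun h => hzp (hfp h)⟩)
    (by rw [Finset.card_erase_of_mem (hes hz), hs.2, hf])
  exact ⟨z, hz, hfz ▸ hfp⟩

theorem exists_pair_of_card_eq_two {E X : Type*} [DecidableEq E] {e : Finset E} (he2 : e.card = 2)
    {o₁ o₂ : Option X} {P : E → X → Prop} (h₁ : ∀ p ∈ o₁, ∃ z ∈ e, P z p)
    (h₂ : ∀ q ∈ o₂, ∃ z ∈ e, P z q) (h : ∀ p ∈ o₁, ∀ q ∈ o₂, ∀ z ∈ e, P z p → ¬ P z q) :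
    ∃ a b, a ≠ b ∧ e = {a, b} ∧ (∀ p ∈ o₁, P b p) ∧ ∀ q ∈ o₂, P a q := by
  obtain ⟨x, y, hxy, rfl⟩ := Finset.card_eq_two.1 he2
  simp only [Finset.mem_insert, Finset.mem_singleton, exists_eq_or_imp, exists_eq_left] at h₁ h₂ h
  suffices ((∀ p ∈ o₁, P y p) ∧ ∀ q ∈ o₂, P x q) ∨ (∀ p ∈ o₁, P x p) ∧ ∀ q ∈ o₂, P y q from
    this.elim (fun h => ⟨x, y, hxy, rfl, h⟩) fun h => ⟨y, x, hxy.symm, Finset.pair_comm x y, h⟩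
  rcases o₁ with _ | p <;> rcases o₂ with _ | q <;> grind

/-- The predecessor and the successor of `s` lie at different sides of `s`, none of which is `e`. -/
theorem IsPartialStrip.exists_orientation (hL : IsModel L) (hl : IsPartialStrip L (l₁ ++ s :: l₂))
    (ht : t ∈ missing L (l₁ ++ s :: l₂)) (he2 : e.card = 2) (hes : e ⊆ s) (het : e ⊆ t) :
    ∃ a b, a ≠ b ∧ e = {a, b} ∧ (∀ p ∈ l₁.getLast?, s.erase b ⊆ p) ∧
      ∀ q ∈ l₂.head?, s.erase a ⊆ q := by
  have hs : s ∈ triangles L := hl.mem_triangles s (by simp)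
  have hst : s ≠ t := fun h => ht.2 (by simp [h])
  have hnodup := hl.nodup
  have hchain := hl.chain
  rw [List.nodup_append, List.nodup_cons] at hnodup
  rw [List.isChain_append, List.isChain_cons] at hchain
  have hside : ∀ p ∈ l₁ ++ s :: l₂, ShareEdge s p → ∃ z ∈ e, s.erase z ⊆ p := fun p hp hsp =>
    hL.exists_erase_subset_of_shareEdge he2 hs ht.1 (hl.mem_triangles p hp) hes het hst
      (fun h => ht.2 (h ▸ hp)) hsp
  have hpre : ∀ p ∈ l₁.getLast?, ∃ z ∈ e, s.erase z ⊆ p := fun p hp =>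
    hside p (by simp [List.mem_of_mem_getLast? hp]) (hchain.2.2 p hp s (by simp)).symm
  have hpost : ∀ q ∈ l₂.head?, ∃ z ∈ e, s.erase z ⊆ q := fun q hq =>
    hside q (by simp [List.mem_of_mem_head? hq]) (hchain.2.1.1 q hq)
  refine exists_pair_of_card_eq_two he2 hpre hpost fun p hp q hq z hz hzp hzq => ?_
  have hpl := List.mem_of_mem_getLast? hp
  have hql := List.mem_of_mem_head? hq
  rcases hL.eq_or_eq_of_edge_subset (by rw [Finset.card_erase_of_mem (hes hz), hs.2]) hs
    (hl.mem_triangles p (by simp [hpl])) (hl.mem_triangles q (by simp [hql]))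
    (Finset.erase_subset z s) hzp hzq (hnodup.2.2 p hpl s (by simp)).symm with rfl | rfl
  · exact hnodup.2.1.1 hql
  · exact hnodup.2.2 q hpl q (by simp [hql]) rfl

/-- The strip through the halves of two triangles `s` and `t` with common edge `{a, b}` whose
midpoint is `m`. It enters `s` at the side opposite to `b` and leaves it at the side opposite to
`a`. -/
def detour (s t : Finset (Space d)) (a b m : Space d) : List (Finset (Space d)) :=
  [exchange s b m, exchange t b m, exchange t a m, exchange s a m]

theorem mem_detour : u ∈ detour s t a b m ↔
    u = exchange s b m ∨ u = exchange t b m ∨ u = exchange t a m ∨ u = exchange s a m := by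
  simp [detour]

theorem mem_of_mem_detour (hu : u ∈ detour s t a b m) : m ∈ u := by
  rcases mem_detour.1 hu with rfl | rfl | rfl | rfl <;> exact Finset.mem_insert_self _ _

theorem shareEdge_exchange_across (hzs : z ∈ s) (hzt : z ∈ t) (has : a ∈ s) (hat : a ∈ t)
    (hza : z ≠ a) (hms : m ∉ s) (hmt : m ∉ t) (hst : s ≠ t) :
    ShareEdge (exchange s z m) (exchange t z m) := by
  refine ⟨fun h => hst ?_, {m, a}, Finset.card_pair (ne_of_mem_of_not_mem has hms).symm,
    Finset.insert_subset_insert _ (by simp [has, hza.symm]),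
    Finset.insert_subset_insert _ (by simp [hat, hza.symm])⟩
  rw [← carrier_exchange (Finset.singleton_subset_iff.2 hzs) (Finset.mem_singleton_self z) hms, h,
    carrier_exchange (Finset.singleton_subset_iff.2 hzt) (Finset.mem_singleton_self z) hmt]

theorem shareEdge_exchange_of_erase_subset (hs : s.card = 3) (hz : z ∈ s) (hm : m ∉ p)
    (hsp : s.erase z ⊆ p) : ShareEdge p (exchange s z m) :=
  ⟨fun h => hm (h ▸ Finset.mem_insert_self _ _), s.erase z,
    by rw [Finset.card_erase_of_mem hz, hs], hsp, Finset.subset_insert _ _⟩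

section Detour

variable (hst : s ≠ t) (hab : a ≠ b) (has : a ∈ s) (hbs : b ∈ s) (hat : a ∈ t) (hbt : b ∈ t)
  (hms : m ∉ s) (hmt : m ∉ t)

include hst hab has hbs hat hbt hms hmt

theorem isChain_detour (ht : t.card = 3) : (detour s t a b m).IsChain ShareEdge :=
  .cons_cons (shareEdge_exchange_across hbs hbt has hat hab.symm hms hmt hst) <|
    .cons_cons (shareEdge_exchange_exchange ht hbt hat hab.symm hmt) <|
      .cons_cons (shareEdge_exchange_across hat has hbt hbs hab hmt hms hst.symm) <|
        .singleton _

theorem nodup_detour : (detour s t a b m).Nodup := by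
  have hsb := (shareEdge_exchange_across hbs hbt has hat hab.symm hms hmt hst).1
  have hsa := (shareEdge_exchange_across hat has hbt hbs hab hmt hms hst.symm).1
  simp only [detour, List.nodup_cons, List.mem_cons, List.not_mem_nil, not_or, or_false,
    not_false_eq_true, List.nodup_nil, and_true]
  exact ⟨⟨hsb, exchange_ne_exchange has hab.symm hms, exchange_ne_exchange has hab.symm hms⟩,
    ⟨exchange_ne_exchange hat hab.symm hmt, exchange_ne_exchange hat hab.symm hmt⟩, hsa⟩

end Detour

theorem nodup_append_append_of_nodup_append_cons {X : Type*} {x : X} {l l₁ l₂ : List X}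
    (h : (l₁ ++ x :: l₂).Nodup) (hl : l.Nodup) (hdisj : ∀ y ∈ l, y ∉ l₁ ++ x :: l₂) :
    (l₁ ++ (l ++ l₂)).Nodup := by
  grind

section Splice

variable (hL : IsModel L) (he : {a, b} ∈ L.faces) (he2 : ({a, b} : Finset (Space d)).card = 2)

include hL in
theorem IsModel.mem_triangles_bisect_iff_mem_detour (hs : s ∈ triangles L) (ht : t ∈ triangles L)
    (hst : s ≠ t) (hes : {a, b} ⊆ s) (het : {a, b} ⊆ t) : u ∈ triangles (bisect L he he2) ↔
      u ∈ triangles L ∧ u ≠ s ∧ u ≠ t ∨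
        u ∈ detour s t a b (Finset.centroid ℝ {a, b} id) := by
  have htwo : ∀ v ∈ triangles L, {a, b} ⊆ v ↔ v = s ∨ v = t := fun v hv =>
    ⟨fun hev => hL.eq_or_eq_of_edge_subset he2 hs ht hv hes het hev hst, by
      rintro (rfl | rfl) <;> assumption⟩
  rw [hL.mem_triangles_bisect he he2, mem_detour]
  refine or_congr (and_congr_right fun hu => (not_congr (htwo u hu)).trans not_or) ⟨?_, ?_⟩
  · rintro ⟨v, hv, hev, z, hz, rfl⟩
    rcases (htwo v hv).1 hev with rfl | rfl <;>
      rcases Finset.mem_insert.1 hz with rfl | hz <;>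
        simp_all
  · rintro (rfl | rfl | rfl | rfl)
    exacts [⟨s, hs, hes, b, by simp, rfl⟩, ⟨t, ht, het, b, by simp, rfl⟩,
      ⟨t, ht, het, a, by simp, rfl⟩, ⟨s, hs, hes, a, by simp, rfl⟩]

variable (hl : IsPartialStrip L (l₁ ++ s :: l₂)) (ht : t ∈ missing L (l₁ ++ s :: l₂))
  (hes : {a, b} ⊆ s) (het : {a, b} ⊆ t)

include hL hl ht hes het

theorem IsPartialStrip.splice (hpre : ∀ p ∈ l₁.getLast?, s.erase b ⊆ p)
    (hpost : ∀ q ∈ l₂.head?, s.erase a ⊆ q) : IsPartialStrip (bisect L he he2)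
      (l₁ ++ (detour s t a b (Finset.centroid ℝ {a, b} id) ++ l₂)) := by
  have hs : s ∈ triangles L := hl.mem_triangles s (by simp)
  have hst : s ≠ t := fun h => ht.2 (by simp [h])
  have hab : a ≠ b := Finset.card_pair_eq_two_iff.1 he2
  obtain ⟨has, hbs⟩ : a ∈ s ∧ b ∈ s := by simpa [Finset.insert_subset_iff] using hes
  obtain ⟨hat, hbt⟩ : a ∈ t ∧ b ∈ t := by simpa [Finset.insert_subset_iff] using het
  have hms := centroid_notMem_of_mem_triangles he he2 hs
  have hmt := centroid_notMem_of_mem_triangles he he2 ht.1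
  have hmem := fun u => hL.mem_triangles_bisect_iff_mem_detour he he2 (u := u) hs ht.1 hst hes het
  have hnotMem : ∀ u ∈ l₁ ++ s :: l₂, Finset.centroid ℝ {a, b} id ∉ u := fun u hu =>
    centroid_notMem_of_mem_triangles he he2 (hl.mem_triangles u hu)
  refine ⟨by simp [detour], ?_, fun u hu => (hmem u).2 ?_, ?_⟩
  · exact nodup_append_append_of_nodup_append_cons hl.nodup
      (nodup_detour hst hab has hbs hat hbt hms hmt)
      fun u hu hul => hnotMem u hul (mem_of_mem_detour hu)
  · have hsl : s ∉ l₁ ++ l₂ := (List.nodup_cons.1 (List.nodup_middle.1 hl.nodup)).1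
    have hor : u ∈ l₁ ++ l₂ ∨ u ∈ detour s t a b (Finset.centroid ℝ {a, b} id) := by
      simp only [List.mem_append] at hu ⊢
      tauto
    refine hor.imp_left fun hu' => ?_
    have hul : u ∈ l₁ ++ s :: l₂ := List.perm_middle.symm.subset (List.mem_cons_of_mem s hu')
    exact ⟨hl.mem_triangles u hul, ne_of_mem_of_not_mem hu' hsl, ne_of_mem_of_not_mem hul ht.2⟩
  · have hchain := hl.chain
    rw [List.isChain_append, List.isChain_cons] at hchain
    refine List.isChain_append.2 ⟨hchain.1, List.isChain_append.2
      ⟨isChain_detour hst hab has hbs hat hbt hms hmt ht.1.2, hchain.2.1.2, ?_⟩, ?_⟩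
    · rintro p hp q hq
      obtain rfl : exchange s a _ = p := Option.some.inj hp
      exact (shareEdge_exchange_of_erase_subset hs.2 has
        (hnotMem q (by simp [List.mem_of_mem_head? hq])) (hpost q hq)).symm
    · rintro p hp q hq
      obtain rfl : exchange s b _ = q := Option.some.inj hq
      exact shareEdge_exchange_of_erase_subset hs.2 hbs
        (hnotMem p (by simp [List.mem_of_mem_getLast? hp])) (hpre p hp)

theorem missing_splice :
    missing (bisect L he he2) (l₁ ++ (detour s t a b (Finset.centroid ℝ {a, b} id) ++ l₂)) =
      missing L (l₁ ++ s :: l₂) \ {t} := by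
  have hs : s ∈ triangles L := hl.mem_triangles s (by simp)
  have hst : s ≠ t := fun h => ht.2 (by simp [h])
  ext u
  have hiff := hL.mem_triangles_bisect_iff_mem_detour he he2 (u := u) hs ht.1 hst hes het
  have hdetour : u ∈ triangles L → u ∉ detour s t a b (Finset.centroid ℝ {a, b} id) :=
    fun hu h => centroid_notMem_of_mem_triangles he he2 hu (mem_of_mem_detour h)
  simp only [missing, Set.mem_sdiff, Set.mem_ofPred_eq, Set.mem_singleton_iff, List.mem_append,
    List.mem_cons, hiff]
  tauto

end Splice

theorem IsPartialStrip.exists_extend (hL : IsModel L) (hconn : EdgeConnected L)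
    (hl : IsPartialStrip L l) (hmissing : (missing L l).Nonempty) :
    ∃ t ∈ missing L l, ∃ e ⊆ t, ∃ (he : e ∈ L.faces) (he2 : e.card = 2),
      ∃ l', IsPartialStrip (bisect L he he2) l' ∧ l'.length = l.length + 3 ∧
        missing (bisect L he he2) l' = missing L l \ {t} := by
  obtain ⟨s, hs, t, ht, -, e, he2, hes, het⟩ := hconn.exists_shareEdge_missing hl hmissing
  obtain ⟨l₁, l₂, rfl⟩ := List.append_of_mem hs
  obtain ⟨a, b, -, rfl, hpre, hpost⟩ := hl.exists_orientation hL ht he2 hes het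
  have he : {a, b} ∈ L.faces := L.down_closed ht.1.1 het (Finset.card_pos.1 (he2 ▸ two_pos))
  refine ⟨t, ht, _, het, he, he2, _, hl.splice hL he he2 ht hes het hpre hpost, ?_,
    missing_splice hL he he2 hl ht hes het⟩
  simp only [detour, List.length_append, List.length_cons, List.length_nil]
  omega

omit [DecidableEq (Space d)] in
theorem IsPartialStrip.exists_isStrip (hL : IsModel L) (hconn : EdgeConnected L)
    (hKL : IsSubdivision K L) (hl : IsPartialStrip L l) (hmissing : missing L l ⊆ triangles K) :
    ∃ (L' : Complex d) (l' : List (Finset (Space d))), IsModel L' ∧ IsSubdivision K L' ∧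
      IsStrip L' l' ∧ l'.length = l.length + 3 * (missing L l).ncard := by
  classical
  induction hn : (missing L l).ncard generalizing L l with
  | zero =>
    have hfin : (missing L l).Finite := hL.finite.subset fun t ht => ht.1.1
    exact ⟨L, l, hL, hKL, hl.isStrip ((Set.ncard_eq_zero hfin).1 hn), by omega⟩
  | succ n ih =>
    obtain ⟨t, ht, e, het, he, he2, l', hl', hlen, hmissing'⟩ :=
      hl.exists_extend hL hconn (Set.nonempty_of_ncard_ne_zero (by omega))
    have heK : e ∈ K.faces :=
      K.down_closed (hmissing ht).1 het (Finset.card_pos.1 (he2 ▸ two_pos))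
    obtain ⟨L', l'', hL', hKL', hl'', hlen'⟩ := ih (isModel_bisect he he2 hL)
      (edgeConnected_bisect he he2 hL hconn) (isSubdivision_bisect he he2 hKL heK) hl'
      (hmissing' ▸ Set.sdiff_subset.trans hmissing)
      (by rw [hmissing', Set.ncard_sdiff_singleton_of_mem ht, hn, Nat.add_sub_cancel])
    exact ⟨L', l'', hL', hKL', hl'', by omega⟩

end PartialStrip

section Bound

theorem two_mul_logb_two_le {n k : ℕ}
    (h : n ≤ 1 + (2 + 1) * ∑ i ∈ Finset.range ((k + 1) / 2), 2 ^ i) :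
    2 * Real.logb 2 n ≤ k + 5 := by
  rcases n.eq_zero_or_pos with rfl | hn
  · rw [Nat.cast_zero, Real.logb_zero, mul_zero]
    positivity
  have hpow : n ≤ 2 ^ ((k + 1) / 2 + 2) := by
    rw [Nat.geomSum_eq le_rfl] at h
    have := Nat.one_le_two_pow (n := (k + 1) / 2)
    rw [pow_add]
    omega
  have hlog : Real.logb 2 n ≤ ((k + 1) / 2 + 2 : ℕ) := by
    rw [← Real.logb_rpow (b := 2) (x := ((k + 1) / 2 + 2 : ℕ)) two_pos (by norm_num),
      Real.rpow_natCast]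
    exact Real.logb_le_logb_of_le one_lt_two (Nat.cast_pos.2 hn) (mod_cast hpow)
  have hhalf : 2 * (((k + 1) / 2 + 2 : ℕ) : ℝ) ≤ k + 5 := by
    exact_mod_cast (by omega : 2 * ((k + 1) / 2 + 2) ≤ k + 5)
  linarith

end Bound

end Strip

theorem theorem4 :
    ∃ C : ℝ, ∀ (d n : ℕ) (K : Strip.Complex d),
      Strip.IsModel K → Strip.EdgeConnected K → (Strip.triangles K).ncard = n →
        ∃ (L : Strip.Complex d) (l : List (Finset (Strip.Space d))),
          Strip.IsModel L ∧ Strip.IsSubdivision K L ∧ Strip.IsStrip L l ∧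
            (l.length : ℝ) ≤ 3 * (n : ℝ) - 4 * Real.logb 2 (n : ℝ) + C := by
  refine ⟨8, fun d n K hK hconn hn => ?_⟩
  have : Finite (Strip.triangles K) := hK.finite.subset fun t ht => ht.1
  obtain ⟨x, y, p, hp, hcard⟩ := Strip.exists_isPath_card_le hconn hK.ncard_neighborSet_le
  obtain ⟨L, l, hL, hKL, hl, hlen⟩ := (Strip.isPartialStrip_of_isPath hp).exists_isStrip hK hconn
    Strip.IsSubdivision.refl fun t ht => ht.1
  have hmissing := (Strip.isPartialStrip_of_isPath hp).ncard_missing_add_length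
  have hlog := Strip.two_mul_logb_two_le hcard
  rw [hn, List.length_map, p.length_support] at hmissing
  rw [List.length_map, p.length_support] at hlen
  rw [Nat.card_coe_set_eq, hn] at hlog
  have htotal : (l.length : ℝ) + 2 * (p.length + 1) = 3 * n := by exact_mod_cast (by omega :
    l.length + 2 * (p.length + 1) = 3 * n)
  exact ⟨L, l, hL, hKL, hl, by linarith⟩
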